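/- Let $\Gamma<\mathrm{PSL}(2,\mathbb C)$ be a discrete, freely acting (torsion-free) group of finite covolume such that the orientable hyperbolic 3-manifold $M=\mathbf H^3/\Gamma$ has exactly one cusp, positioned so that $\infty$ is a parabolic fixed point of $\Gamma$. Let $\Gamma_1,\Gamma_2\le\Gamma$ be subgroups of the same finite index $n$ such that the covers $M_i=\mathbf H^3/\Gamma_i$ of $M$ have exactly one cusp. Use coordinates $w=(z,y)$, $z\in\mathbf C$, $y>0$, on $\mathbf H^3$. For $G\in\{\Gamma,\Gamma_1,\Gamma_2\}$ let $P_G$ be the maximal peripheral subgroup of $G$ at $\infty$ (the group of all translations $z\mapsto z+b$ in $G$; so $P_{\Gamma_i}=\Gamma_i\cap P_\Gamma$), and let $$E_G(w,s)=\sum_{\gamma\in P_G\backslash G} y(\gamma w)^s$$ be the Eisenstein series of $G$ at $\infty$, where $y(p)$ is the height of $p$. The scattering function $\phi_G$ is the meromorphic function on $\mathbf C$ for which, when $\mathrm{Re}(s)>2$, the series $E_G(w,s)$ has as constant term of its Fourier expansion at $\infty$ (its average in $z$ over a fundamental domain of the group of translation vectors of $P_G$) the function $y^s+\phi_G(s)\,y^{2-s}$.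 Then: (a) for $i=1,2$ there is a system of $n$ representatives of the cosets $\delta\Gamma_i$ ($\delta\in\Gamma$) contained in $P_\Gamma$; (b) $E_{\Gamma_1}(w,s)=E_\Gamma(w,s)=E_{\Gamma_2}(w,s)$: for all $w\in\mathbf H^3$, $s\in\mathbf C$, if one of the three series converges absolutely then so do the others, with the same sum; the same equality holds for the meromorphic continuations in $s$; (c) for all $s\in\mathbf C$ and $y>0$ the constant terms at $\infty$ of the three series agree, and $M_1$, $M_2$ (and $M$) have the same scattering function: $\phi_{\Gamma_1}=\phi_\Gamma=\phi_{\Gamma_2}$. -/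

import Mathlib

open MeasureTheory Matrix
open scoped MatrixGroups LinearAlgebra.Projectivization ComplexConjugate

noncomputable section

namespace CuspedHyp

/-! ### Hyperbolic 3-space and its orientation-preserving isometries -/

/-- The upper half-space model `{(z, y) : z ∈ ℂ, y > 0}` of hyperbolic 3-space. -/
abbrev H3 : Type := {p : ℂ × ℝ // 0 < p.2}

/-- The point `(z, y)` of hyperbolic 3-space. -/
def H3.mk (z : ℂ) (y : ℝ) (hy : 0 < y) : H3 := ⟨(z, y), hy⟩

/-- The height `y(p)` of `p = (z, y)`. -/
def height (p : H3) : ℝ := p.1.2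

/-- The hyperbolic volume, with density `y⁻³` against Lebesgue measure. -/
def hypVolume : Measure H3 :=
  Measure.comap Subtype.val
    ((volume : Measure (ℂ × ℝ)).withDensity fun p => ENNReal.ofReal ((p.2 ^ 3)⁻¹))

/-- The quantity `|cz + d|² + |c|² y²`. -/
def denom (A : SL(2, ℂ)) (p : H3) : ℝ :=
  Complex.normSq (A 1 0 * p.1.1 + A 1 1) + Complex.normSq (A 1 0) * p.1.2 ^ 2

/-- The quantity `(az + b) conj(cz + d) + a conj(c) y²`. -/
def numer (A : SL(2, ℂ)) (p : H3) : ℂ :=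
  (A 0 0 * p.1.1 + A 0 1) * conj (A 1 0 * p.1.1 + A 1 1)
    + A 0 0 * conj (A 1 0) * (p.1.2 : ℂ) ^ 2

theorem det_eq (A : SL(2, ℂ)) : A 0 0 * A 1 1 - A 0 1 * A 1 0 = 1 := by
  have h := A.det_coe
  rwa [Matrix.det_fin_two] at h

theorem denom_pos (A : SL(2, ℂ)) (p : H3) : 0 < denom A p := by
  have hy : 0 < p.1.2 ^ 2 := pow_pos p.2 2
  unfold denom
  by_cases hc : A 1 0 = 0
  · have hd : A 1 1 ≠ 0 := by
      intro hd
      have := det_eq A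
      simp [hc, hd] at this
    simpa [hc] using hd
  · have h1 := Complex.normSq_nonneg (A 1 0 * p.1.1 + A 1 1)
    have h2 : 0 < Complex.normSq (A 1 0) := Complex.normSq_pos.2 hc
    positivity

theorem denom_cast (A : SL(2, ℂ)) (p : H3) : (denom A p : ℂ) =
    (A 1 0 * p.1.1 + A 1 1) * (conj (A 1 0) * conj p.1.1 + conj (A 1 1))
      + A 1 0 * conj (A 1 0) * (p.1.2 : ℂ) ^ 2 := by
  simp [denom, Complex.normSq_eq_conj_mul_self, mul_comm]

/-- The action of a matrix by the Poincaré extension of its Möbius transformation. -/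
def slAct (A : SL(2, ℂ)) (p : H3) : H3 :=
  ⟨(numer A p / (denom A p : ℂ), p.1.2 / denom A p), div_pos p.2 (denom_pos A p)⟩

theorem numer_normSq (A : SL(2, ℂ)) (p : H3) :
    numer A p * conj (numer A p) + (p.1.2 : ℂ) ^ 2 =
      (denom A p : ℂ) * ((A 0 0 * p.1.1 + A 0 1) * (conj (A 0 0) * conj p.1.1 + conj (A 0 1))
        + A 0 0 * conj (A 0 0) * (p.1.2 : ℂ) ^ 2) := by
  have h := det_eq A
  have h' : conj (A 0 0) * conj (A 1 1) - conj (A 0 1) * conj (A 1 0) = 1 := by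
    rw [← map_mul, ← map_mul, ← map_sub, h, map_one]
  rw [denom_cast]
  simp only [numer, map_add, map_mul, map_pow, Complex.conj_conj, Complex.conj_ofReal]
  linear_combination (-(p.1.2 : ℂ) ^ 2 * (conj (A 0 0) * conj (A 1 1) - conj (A 0 1) * conj (A 1 0))) * h
    - (p.1.2 : ℂ) ^ 2 * h'

theorem mul_apply' (B A : SL(2, ℂ)) (i j : Fin 2) :
    (B * A) i j = B i 0 * A 0 j + B i 1 * A 1 j := by
  simp [Matrix.mul_apply, Fin.sum_univ_two]

theorem denom_mul (B A : SL(2, ℂ)) (p : H3) :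
    denom (B * A) p = denom B (slAct A p) * denom A p := by
  have hN : (denom A p : ℂ) ≠ 0 := by exact_mod_cast (denom_pos A p).ne'
  apply Complex.ofReal_injective
  have key := numer_normSq A p
  rw [Complex.ofReal_mul, denom_cast B, denom_cast (B * A)]
  simp only [slAct, map_div₀, Complex.conj_ofReal, Complex.ofReal_div, mul_apply', map_add, map_mul]
  field_simp
  rw [denom_cast] at *
  simp only [numer, map_add, map_mul, map_pow, Complex.conj_conj, Complex.conj_ofReal] at *
  linear_combination (-(B 1 0 * conj (B 1 0))) * key

theorem numer_mul (B A : SL(2, ℂ)) (p : H3) :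
    numer (B * A) p = numer B (slAct A p) * denom A p := by
  have hN : (denom A p : ℂ) ≠ 0 := by exact_mod_cast (denom_pos A p).ne'
  have key := numer_normSq A p
  rw [numer, numer]
  simp only [slAct, map_div₀, Complex.conj_ofReal, Complex.ofReal_div, mul_apply', map_add, map_mul]
  field_simp
  rw [denom_cast] at *
  simp only [numer, map_add, map_mul, map_pow, Complex.conj_conj, Complex.conj_ofReal] at *
  linear_combination (-(B 0 0 * conj (B 1 0))) * key

instance : MulAction SL(2, ℂ) H3 where
  smul := slAct
  one_smul p := by
    change slAct 1 p = p
    apply Subtype.ext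
    simp [slAct, numer, denom]
  mul_smul B A p := by
    change slAct (B * A) p = slAct B (slAct A p)
    have hN : (denom A p : ℂ) ≠ 0 := by exact_mod_cast (denom_pos A p).ne'
    have hM : (denom B (slAct A p) : ℂ) ≠ 0 := by exact_mod_cast (denom_pos B _).ne'
    apply Subtype.ext
    refine Prod.ext ?_ ?_
    · change numer (B * A) p / (denom (B * A) p : ℂ) =
        numer B (slAct A p) / (denom B (slAct A p) : ℂ)
      rw [numer_mul, denom_mul, Complex.ofReal_mul, mul_div_mul_right _ _ hN]
    · change p.1.2 / denom (B * A) p = p.1.2 / denom A p / denom B (slAct A p)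
      rw [denom_mul, div_div, mul_comm]

theorem center_smul (A : SL(2, ℂ)) (hA : A ∈ Subgroup.center SL(2, ℂ)) (p : H3) : A • p = p := by
  obtain ⟨r, hr, hA⟩ := Matrix.SpecialLinearGroup.mem_center_iff.1 hA
  have e (i j : Fin 2) : A i j = Matrix.scalar (Fin 2) r i j := by rw [hA]
  have hr2 : r * r = 1 := by simpa [sq] using hr
  have hn : Complex.normSq r = 1 := by
    have h1 : Complex.normSq r * Complex.normSq r = 1 := by
      rw [← map_mul, hr2, map_one]
    nlinarith [Complex.normSq_nonneg r]
  have hn' : r * conj r = 1 := by rw [Complex.mul_conj, hn, Complex.ofReal_one]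
  change slAct A p = p
  apply Subtype.ext
  refine Prod.ext ?_ ?_
  · simp only [slAct, numer, denom, e]
    simp [hn]
    linear_combination p.1.1 * hn'
  · simp [slAct, denom, e, hn]

/-- The action of `PSL(2, ℂ)` on hyperbolic 3-space induced by that of `SL(2, ℂ)`. -/
instance : MulAction PSL(2, ℂ) H3 :=
  MulAction.compHom H3 (QuotientGroup.lift (Subgroup.center SL(2, ℂ))
    (MulAction.toPermHom SL(2, ℂ) H3) fun A hA => Equiv.ext fun p => center_smul A hA p)

theorem coe_smul (A : SL(2, ℂ)) (p : H3) : (A : PSL(2, ℂ)) • p = A • p := rfl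

/-! ### Kleinian groups of hyperbolic 3-manifolds, and their cusps -/

/-- `H3 / Γ` is an orientable hyperbolic 3-manifold of finite volume: `Γ` is discrete, acts freely,
and has a fundamental domain of finite hyperbolic volume. -/
structure IsFiniteVolumeManifoldGroup (Γ : Subgroup PSL(2, ℂ)) : Prop where
  discrete : DiscreteTopology Γ
  free : ∀ γ ∈ Γ, ∀ p : H3, γ • p = p → γ = 1
  finite_volume : ∃ D : Set H3, IsFundamentalDomain Γ D hypVolume ∧ hypVolume D < ⊤

/-- The sphere at infinity, on which `PSL(2, ℂ)` acts by Möbius transformations. -/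
abbrev Boundary : Type := ℙ ℂ (Fin 2 → ℂ)

/-- The point `∞ = [1 : 0]` of the sphere at infinity. -/
def infty : Boundary := Projectivization.mk ℂ ![1, 0] (by simp)

/-- A parabolic isometry. -/
def IsParabolic (g : PSL(2, ℂ)) : Prop :=
  ∃ A : SL(2, ℂ), (A : PSL(2, ℂ)) = g ∧ (A : Matrix (Fin 2) (Fin 2) ℂ).IsParabolic

/-- `c` is a cusp (parabolic fixed point) of `Γ`. -/
def IsCuspOf (Γ : Subgroup PSL(2, ℂ)) (c : Boundary) : Prop :=
  ∃ g ∈ Γ, IsParabolic g ∧ g • c = c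

/-- `Γ` has exactly one cusp up to the action of `Γ`. -/
def HasOneCusp (Γ : Subgroup PSL(2, ℂ)) : Prop :=
  ∃ c, IsCuspOf Γ c ∧ ∀ c', IsCuspOf Γ c' → ∃ γ ∈ Γ, γ • c = c'

/-! ### The peripheral subgroup at infinity -/

/-- The matrix of the translation by `b`. -/
def translationMatrix (b : ℂ) : SL(2, ℂ) :=
  ⟨!![1, b; 0, 1], by simp [Matrix.det_fin_two]⟩

/-- The isometry `(z, y) ↦ (z + b, y)`. -/
def translation (b : ℂ) : PSL(2, ℂ) := QuotientGroup.mk (translationMatrix b)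

theorem translation_add (b c : ℂ) : translation (b + c) = translation b * translation c := by
  unfold translation
  rw [← QuotientGroup.mk_mul]
  refine congrArg QuotientGroup.mk (Matrix.SpecialLinearGroup.ext _ _ fun i j => ?_)
  rw [mul_apply']
  fin_cases i <;> fin_cases j <;> simp [translationMatrix, add_comm]

theorem translation_zero : translation 0 = 1 := by
  have h := translation_add 0 0
  rw [add_zero] at h
  exact (mul_eq_left.1 h.symm)

theorem translation_neg (b : ℂ) : translation (-b) = (translation b)⁻¹ := by
  rw [eq_inv_iff_mul_eq_one, ← translation_add, neg_add_cancel, translation_zero]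

theorem translation_smul (b z : ℂ) (y : ℝ) (hy : 0 < y) :
    translation b • H3.mk z y hy = H3.mk (z + b) y hy := by
  change slAct _ _ = _
  apply Subtype.ext
  simp [slAct, numer, denom, H3.mk, translationMatrix]

theorem height_translation (b : ℂ) (p : H3) : height (translation b • p) = height p := by
  obtain ⟨⟨z, y⟩, hy⟩ := p
  change height (translation b • H3.mk z y hy) = height (H3.mk z y hy)
  rw [translation_smul]
  rfl

/-- The maximal peripheral subgroup of `Γ` at `∞`: the identity and the parabolic elements of `Γ`
fixing `∞`, that is, all the translations `z ↦ z + b` in `Γ`. -/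
def peripheral (Γ : Subgroup PSL(2, ℂ)) : Subgroup PSL(2, ℂ) where
  carrier := {g | g ∈ Γ ∧ ∃ b : ℂ, translation b = g}
  one_mem' := ⟨Γ.one_mem, 0, translation_zero⟩
  mul_mem' := by
    rintro _ _ ⟨hg, b, rfl⟩ ⟨hh, c, rfl⟩
    exact ⟨Γ.mul_mem hg hh, b + c, translation_add b c⟩
  inv_mem' := by
    rintro _ ⟨hg, b, rfl⟩
    exact ⟨Γ.inv_mem hg, -b, translation_neg b⟩

/-- The group of translation vectors of the peripheral subgroup of `Γ` at `∞`. -/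
def periods (Γ : Subgroup PSL(2, ℂ)) : AddSubgroup ℂ where
  carrier := {b | translation b ∈ Γ}
  zero_mem' := by
    change translation 0 ∈ Γ
    rw [translation_zero]
    exact Γ.one_mem
  add_mem' {b c} hb hc := by
    change translation (b + c) ∈ Γ
    rw [translation_add]
    exact Γ.mul_mem hb hc
  neg_mem' {b} hb := by
    change translation (-b) ∈ Γ
    rw [translation_neg]
    exact Γ.inv_mem hb

/-! ### The Eisenstein series at infinity and the scattering function -/

/-- The set `P \ Γ` of cosets `P γ`, with `P` the peripheral subgroup of `Γ` at `∞`. -/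
abbrev PeripheralCosets (Γ : Subgroup PSL(2, ℂ)) : Type :=
  Quotient (QuotientGroup.rightRel ((peripheral Γ).subgroupOf Γ))

/-- The term `y(γ w)^s` of the Eisenstein series, as a function of the coset `P γ`. -/
def eisensteinTerm (Γ : Subgroup PSL(2, ℂ)) (w : H3) (s : ℂ) : PeripheralCosets Γ → ℂ :=
  Quotient.lift (fun γ : Γ => (height (γ • w) : ℂ) ^ s) (by
    intro γ δ h
    obtain ⟨-, b, hb⟩ := Subgroup.mem_subgroupOf.1 (QuotientGroup.rightRel_apply.1 h)
    have e : (δ : PSL(2, ℂ)) = translation b * (γ : PSL(2, ℂ)) := by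
      rw [hb]
      simp
    have e' : δ • w = translation b • γ • w := by
      change (δ : PSL(2, ℂ)) • w = translation b • (γ : PSL(2, ℂ)) • w
      rw [e, mul_smul]
    change (height (γ • w) : ℂ) ^ s = (height (δ • w) : ℂ) ^ s
    rw [e', height_translation])

/-- The Eisenstein series `E(w, s) = ∑_{γ ∈ P \ Γ} y(γ w)^s` of `Γ` at the cusp `∞`. -/
def eisenstein (Γ : Subgroup PSL(2, ℂ)) (w : H3) (s : ℂ) : ℂ :=
  ∑' γ : PeripheralCosets Γ, eisensteinTerm Γ w s γ

/-- `F` is the Eisenstein series as a function of all `s ∈ ℂ`: the series converges to `F w s` for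
`Re s > 2`, and `s ↦ F w s` is meromorphic on `ℂ`. (Normal form only fixes the values of a
meromorphic function at its poles and removable singularities.) -/
def IsEisensteinFunction (Γ : Subgroup PSL(2, ℂ)) (F : H3 → ℂ → ℂ) : Prop :=
  ∀ w, MeromorphicNFOn (F w) Set.univ ∧
    ∀ s : ℂ, 2 < s.re → HasSum (eisensteinTerm Γ w s) (F w s)

/-- `a` is the constant term of the Fourier expansion of the `L`-periodic function `f`: its average
over a fundamental domain of `L` in `ℂ`. -/
def HasConstantTerm (L : AddSubgroup ℂ) (f : ℂ → ℂ) (a : ℂ) : Prop :=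
  ∃ D : Set ℂ, IsAddFundamentalDomain L D volume ∧ volume D < ⊤ ∧
    IntegrableOn f D volume ∧ ⨍ z in D, f z = a

/-- `φ` is the scattering function of `Γ` at the cusp `∞`: a meromorphic function on `ℂ` such that,
for `Re s > 2`, the Eisenstein series converges and its Fourier expansion at `∞` has the constant
term `y^s + φ(s) y^(2-s)`. -/
def IsScatteringFunction (Γ : Subgroup PSL(2, ℂ)) (φ : ℂ → ℂ) : Prop :=
  MeromorphicNFOn φ Set.univ ∧
    ∀ s : ℂ, 2 < s.re → ∀ (y : ℝ) (hy : 0 < y),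
      (∀ z : ℂ, Summable (eisensteinTerm Γ (H3.mk z y hy) s)) ∧
      HasConstantTerm (periods Γ) (fun z => eisenstein Γ (H3.mk z y hy) s)
        ((y : ℂ) ^ s + φ s * (y : ℂ) ^ (2 - s))

/-- `S` consists of `n` elements and contains exactly one element of each coset `δ G`, `δ ∈ Γ`. -/
def IsCosetRepresentatives (Γ G : Subgroup PSL(2, ℂ)) (n : ℕ) (S : Set PSL(2, ℂ)) : Prop :=
  S ⊆ Γ ∧ S.ncard = n ∧ ∀ γ ∈ Γ, ∃! δ, δ ∈ S ∧ ∃ g ∈ G, γ = δ * g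

end CuspedHyp

end

/-!
The point is the decomposition `Γ = P Γ₁`, where `P` is the peripheral subgroup of `Γ` at `∞`
and `Γ₁` is a finite index subgroup with one cusp. Every point of the orbit `Γ ∞` is a parabolic
fixed point of `Γ₁`, because a power of each conjugate of a translation of `Γ` lies in `Γ₁`. As
`Γ₁` has one cusp, it permutes these points transitively, so each `γ ∈ Γ` is, up to right
multiplication by an element of `Γ₁`, in the stabilizer of `∞`
(`CuspedHyp.exists_peripheral_mul_eq`). That stabilizer is `P`
(`CuspedHyp.mem_peripheral_of_smul_infty`): an element `z ↦ a² z + b'` with `|a| ≠ 1` would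
conjugate a translation of `Γ` to arbitrarily short ones, against discreteness, while one with
`|a| = 1`, `a² ≠ 1` would fix a vertical line pointwise.

The decomposition gives coset representatives in `P`, and a bijection from `P₁ \ Γ₁` to `P \ Γ`,
where `P₁ = P ∩ Γ₁`, that respects the terms `y(γ w)^s`
(`CuspedHyp.peripheralCosetsMap_bijective`). Hence the Eisenstein series agree term by term.

The constant terms are averages over fundamental domains of two different lattices, the periods
of `Γ₁` and those of `Γ`. Finitely many translates of a fundamental domain of the larger lattice
form one of the sublattice, with the same average of any function periodic under the larger
lattice (`CuspedHyp.hasConstantTerm_iff_of_le`). Uniqueness of the meromorphic functions follows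
from the identity theorem, normal form fixing the values at the exceptional points.
-/

namespace CuspedHyp

/-! ### Translations and the stabilizer of the cusp at infinity -/

theorem mk_smul_infty_eq_iff (A : SL(2, ℂ)) :
    (A : PSL(2, ℂ)) • infty = infty ↔ A 1 0 = 0 := by
  rw [Matrix.ProjectiveSpecialLinearGroup.smul_proj_mk, infty, Projectivization.smul_mk,
    Projectivization.mk_eq_mk_iff']
  change (∃ a : ℂ, a • ![1, 0] = (A : Matrix (Fin 2) (Fin 2) ℂ) *ᵥ ![1, 0]) ↔ _
  constructor
  · rintro ⟨a, ha⟩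
    have := congrFun ha 1
    simpa [Matrix.mulVec, dotProduct, Fin.sum_univ_two] using this.symm
  · intro h
    refine ⟨A 0 0, ?_⟩
    ext i
    fin_cases i <;> simp [Matrix.mulVec, dotProduct, Fin.sum_univ_two, h]

theorem translation_smul_infty (b : ℂ) : translation b • infty = infty :=
  (mk_smul_infty_eq_iff _).2 (by simp [translationMatrix])

theorem translation_eq_one_iff {b : ℂ} : translation b = 1 ↔ b = 0 := by
  refine ⟨fun h => ?_, fun h => h ▸ translation_zero⟩
  have h1 := translation_smul b 0 1 one_pos
  rw [h, one_smul] at h1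
  simpa [H3.mk] using h1.symm

theorem translation_nsmul (k : ℕ) (b : ℂ) : translation (k • b) = translation b ^ k := by
  induction k with
  | zero => simp [translation_zero]
  | succ k ih => rw [succ_nsmul, translation_add, ih, pow_succ]

theorem continuous_translation : Continuous translation := by
  have h : Continuous translationMatrix := by
    refine Continuous.subtype_mk ?_ _
    refine continuous_matrix fun i j => ?_
    fin_cases i <;> fin_cases j <;> simp <;> fun_prop
  exact QuotientGroup.continuous_mk.comp h

/-- An upper triangular matrix with diagonal `(a, a⁻¹)` conjugates the translation by `b` to the
translation by `a² b`. -/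
theorem mk_mul_translation_mul_inv {A : SL(2, ℂ)} (hA : A 1 0 = 0) (b : ℂ) :
    (A : PSL(2, ℂ)) * translation b * (A : PSL(2, ℂ))⁻¹ = translation (A 0 0 ^ 2 * b) := by
  rw [mul_inv_eq_iff_eq_mul]
  unfold translation
  rw [← QuotientGroup.mk_mul, ← QuotientGroup.mk_mul]
  have hd : A 0 0 * A 1 1 = 1 := by simpa [hA] using det_eq A
  refine congrArg QuotientGroup.mk (Matrix.SpecialLinearGroup.ext _ _ fun i j => ?_)
  rw [mul_apply', mul_apply']
  fin_cases i <;> fin_cases j <;> simp [translationMatrix, hA]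
  linear_combination (-(A 0 0 * b)) * hd

theorem isParabolic_translation {b : ℂ} (hb : b ≠ 0) : IsParabolic (translation b) := by
  refine ⟨_, rfl, ?_⟩
  rw [Matrix.isParabolic_iff_of_upperTriangular (by simp [translationMatrix])]
  simpa [translationMatrix] using hb

theorem IsParabolic.conj {g : PSL(2, ℂ)} (hg : IsParabolic g) (γ : PSL(2, ℂ)) :
    IsParabolic (γ * g * γ⁻¹) := by
  obtain ⟨A, rfl, hA⟩ := hg
  obtain ⟨B, rfl⟩ := QuotientGroup.mk_surjective γ
  refine ⟨B * A * B⁻¹, rfl, ?_⟩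
  have h := (Matrix.isParabolic_conj_iff (m := (A : Matrix (Fin 2) (Fin 2) ℂ))
    (B : GL (Fin 2) ℂ)).2 hA
  convert h using 1
  rw [Matrix.SpecialLinearGroup.coe_mul, Matrix.SpecialLinearGroup.coe_mul]
  congr 1
  rw [← Matrix.coe_units_inv]
  rfl

/-- An upper triangular matrix with equal diagonal entries, necessarily `± 1`, acts as a
translation. -/
theorem mk_eq_translation {A : SL(2, ℂ)} (hc : A 1 0 = 0) (h : A 0 0 = A 1 1) :
    (A : PSL(2, ℂ)) = translation (A 0 1 * A 0 0) := by
  have hd : A 0 0 * A 0 0 = 1 := by simpa [hc, ← h] using det_eq A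
  -- The two matrices differ by the central factor `A 0 0`.
  refine ((QuotientGroup.eq).2 (Matrix.SpecialLinearGroup.mem_center_iff.2
    ⟨A 0 0, by rw [Fintype.card_fin, sq, hd], ?_⟩)).symm
  ext i j
  rw [mul_apply', Matrix.SpecialLinearGroup.SL2_inv_expl]
  fin_cases i <;> fin_cases j <;> simp [translationMatrix, hc, ← h]
  linear_combination A 0 1 * hd

/-- If `∞` is a parabolic fixed point of a group, the group contains a nontrivial translation. -/
theorem IsCuspOf.exists_translation_mem {Γ : Subgroup PSL(2, ℂ)} (h : IsCuspOf Γ infty) :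
    ∃ b ≠ 0, translation b ∈ Γ := by
  obtain ⟨_, hg, ⟨A, rfl, hA⟩, hfix⟩ := h
  have hc := (mk_smul_infty_eq_iff A).1 hfix
  obtain ⟨h1, h2⟩ := (Matrix.isParabolic_iff_of_upperTriangular hc).1 hA
  have ha : A 0 0 ≠ 0 := left_ne_zero_of_mul_eq_one (by simpa [hc] using det_eq A)
  exact ⟨A 0 1 * A 0 0, mul_ne_zero h2 ha, mk_eq_translation hc h1 ▸ hg⟩

/-- The periods of a discrete group are isolated. -/
theorem exists_forall_mem_periods_norm_lt {Γ : Subgroup PSL(2, ℂ)} (hΓ : DiscreteTopology Γ) :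
    ∃ ε > 0, ∀ b ∈ periods Γ, ‖b‖ < ε → b = 0 := by
  obtain ⟨U, hU, hUΓ⟩ := (mem_nhds_subtype _ _ _).1
    ((discreteTopology_iff_singleton_mem_nhds.1 hΓ) 1)
  have h0 : translation ⁻¹' U ∈ nhds 0 :=
    continuous_translation.continuousAt.preimage_mem_nhds (by rw [translation_zero]; exact hU)
  obtain ⟨ε, hε, hεU⟩ := Metric.mem_nhds_iff.1 h0
  refine ⟨ε, hε, fun b hb hlt => translation_eq_one_iff.1 ?_⟩
  have hbU : translation b ∈ U := hεU (by simpa using hlt)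
  have : (⟨translation b, hb⟩ : Γ) ∈ ({1} : Set Γ) := hUΓ hbU
  simpa using congrArg Subtype.val this

theorem mk_pow_mul_mem_periods {Γ : Subgroup PSL(2, ℂ)} {A : SL(2, ℂ)}
    (hA : (A : PSL(2, ℂ)) ∈ Γ) (hc : A 1 0 = 0) {b : ℂ} (hb : b ∈ periods Γ) (k : ℕ) :
    (A 0 0 ^ 2) ^ k * b ∈ periods Γ := by
  induction k with
  | zero => simpa using hb
  | succ k ih =>
    change translation _ ∈ Γ
    rw [pow_succ', mul_assoc, ← mk_mul_translation_mul_inv hc]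
    exact Γ.mul_mem (Γ.mul_mem hA ih) (Γ.inv_mem hA)

/-- In a discrete group containing a nontrivial translation, no element fixing `∞` contracts `ℂ`:
its conjugates of the translation would be arbitrarily short. -/
theorem one_le_norm_of_upperTriangular {Γ : Subgroup PSL(2, ℂ)} (hΓ : DiscreteTopology Γ)
    {b : ℂ} (hb0 : b ≠ 0) (hb : b ∈ periods Γ) {A : SL(2, ℂ)} (hA : (A : PSL(2, ℂ)) ∈ Γ)
    (hc : A 1 0 = 0) : 1 ≤ ‖A 0 0‖ := by
  by_contra! hlt
  obtain ⟨ε, hε, hmin⟩ := exists_forall_mem_periods_norm_lt hΓ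
  have hd : A 0 0 * A 1 1 = 1 := by simpa [hc] using det_eq A
  have ha : A 0 0 ≠ 0 := left_ne_zero_of_mul_eq_one hd
  have hlim : Filter.Tendsto (fun k : ℕ => ‖(A 0 0 ^ 2) ^ k * b‖) Filter.atTop (nhds 0) := by
    have := (tendsto_pow_atTop_nhds_zero_of_norm_lt_one (x := A 0 0 ^ 2)
      (by rw [norm_pow]; exact pow_lt_one₀ (norm_nonneg _) hlt two_ne_zero)).mul_const b
    simpa using this.norm
  obtain ⟨k, hk⟩ := (hlim.eventually_lt_const hε).exists
  exact mul_ne_zero (pow_ne_zero _ (pow_ne_zero _ ha)) hb0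
    (hmin _ (mk_pow_mul_mem_periods hA hc hb k) hk)

/-- The elements of the group of a hyperbolic manifold that fix a cusp at `∞` are translations:
by discreteness their multiplier `a²` has modulus one, and if it is not `1` then they are
rotations about a vertical axis, which do not act freely. -/
theorem mem_peripheral_of_smul_infty {Γ : Subgroup PSL(2, ℂ)} (hΓ : IsFiniteVolumeManifoldGroup Γ)
    (hinfty : IsCuspOf Γ infty) {g : PSL(2, ℂ)} (hg : g ∈ Γ) (hfix : g • infty = infty) :
    g ∈ peripheral Γ := by
  refine ⟨hg, ?_⟩
  obtain ⟨b, hb0, hb⟩ := hinfty.exists_translation_mem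
  obtain ⟨A, rfl⟩ := QuotientGroup.mk_surjective g
  have hc := (mk_smul_infty_eq_iff A).1 hfix
  have hd : A 0 0 * A 1 1 = 1 := by simpa [hc] using det_eq A
  have hn : ‖A 0 0‖ = 1 := by
    have h1 := one_le_norm_of_upperTriangular hΓ.discrete hb0 hb hg hc
    have h2 := one_le_norm_of_upperTriangular hΓ.discrete hb0 hb (A := A⁻¹)
      (by simpa using Γ.inv_mem hg) (by simp [Matrix.SpecialLinearGroup.SL2_inv_expl, hc])
    have h3 : (A⁻¹ : SL(2, ℂ)) 0 0 = A 1 1 := by simp [Matrix.SpecialLinearGroup.SL2_inv_expl]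
    rw [h3] at h2
    have h4 : ‖A 0 0‖ * ‖A 1 1‖ = 1 := by rw [← norm_mul, hd, norm_one]
    nlinarith
  by_cases ha : A 0 0 = A 1 1
  · exact ⟨_, (mk_eq_translation hc ha).symm⟩
  · have hn' : Complex.normSq (A 1 1) = 1 := by
      have h4 : ‖A 0 0‖ * ‖A 1 1‖ = 1 := by rw [← norm_mul, hd, norm_one]
      rw [hn, one_mul] at h4
      rw [Complex.normSq_eq_norm_sq, h4, one_pow]
    have hne : A 1 1 - A 0 0 ≠ 0 := sub_ne_zero.2 (Ne.symm ha)
    have hfixed : A • H3.mk (A 0 1 / (A 1 1 - A 0 0)) 1 one_pos =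
        H3.mk (A 0 1 / (A 1 1 - A 0 0)) 1 one_pos := by
      change slAct _ _ = _
      have hz : A 0 0 * (A 0 1 / (A 1 1 - A 0 0)) + A 0 1 =
          A 1 1 * (A 0 1 / (A 1 1 - A 0 0)) := by
        field_simp
        ring
      have hdd : A 1 1 * conj (A 1 1) = 1 := by rw [Complex.mul_conj, hn', Complex.ofReal_one]
      apply Subtype.ext
      simp only [slAct, numer, denom, H3.mk, hc, zero_mul, zero_add, map_zero, add_zero, hn',
        Complex.ofReal_one, div_one, mul_zero]
      rw [hz]
      refine Prod.ext ?_ rfl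
      linear_combination (A 0 1 / (A 1 1 - A 0 0)) * hdd
    have h1 := hΓ.free _ hg _ ((coe_smul A _).trans hfixed)
    exact ⟨0, translation_zero.trans h1.symm⟩

/-! ### Coset representatives in the peripheral subgroup -/

/-- A power of each conjugate in `Γ` of a translation of `Γ` lies in `Γ₁`, and is parabolic. -/
theorem isCuspOf_smul_infty {Γ Γ₁ : Subgroup PSL(2, ℂ)} (hinfty : IsCuspOf Γ infty)
    (hfin : Γ₁.relIndex Γ ≠ 0) {γ : PSL(2, ℂ)} (hγ : γ ∈ Γ) : IsCuspOf Γ₁ (γ • infty) := by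
  obtain ⟨b, hb0, hb⟩ := hinfty.exists_translation_mem
  obtain ⟨k, hk, -, hmem⟩ := Subgroup.exists_pow_mem_of_relIndex_ne_zero hfin
    (Γ.mul_mem (Γ.mul_mem hγ hb) (Γ.inv_mem hγ))
  refine ⟨_, hmem.1, ?_, ?_⟩
  · rw [conj_pow, ← translation_nsmul]
    exact (isParabolic_translation (smul_ne_zero hk.ne' hb0)).conj γ
  · rw [conj_pow, ← translation_nsmul, mul_smul, inv_smul_smul, mul_smul, translation_smul_infty]

/-- The heart of the argument: `Γ = P Γ₁`. For `γ ∈ Γ`, both `∞` and `γ⁻¹ ∞` are cusps of `Γ₁`, so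
some `δ ∈ Γ₁` maps `∞` to `γ⁻¹ ∞`, and `γ δ` lies in the stabilizer `P` of `∞`. -/
theorem exists_peripheral_mul_eq {Γ Γ₁ : Subgroup PSL(2, ℂ)}
    (hΓ : IsFiniteVolumeManifoldGroup Γ) (hinfty : IsCuspOf Γ infty) (h₁ : Γ₁ ≤ Γ)
    (hfin : Γ₁.relIndex Γ ≠ 0) (hcusp₁ : HasOneCusp Γ₁) {γ : PSL(2, ℂ)} (hγ : γ ∈ Γ) :
    ∃ p ∈ peripheral Γ, ∃ δ ∈ Γ₁, p * δ = γ := by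
  obtain ⟨c, -, hc⟩ := hcusp₁
  obtain ⟨α, hα, hα'⟩ := hc infty (by simpa using isCuspOf_smul_infty hinfty hfin Γ.one_mem)
  obtain ⟨β, hβ, hβ'⟩ := hc _ (isCuspOf_smul_infty hinfty hfin (Γ.inv_mem hγ))
  have hδ : β * α⁻¹ ∈ Γ₁ := Γ₁.mul_mem hβ (Γ₁.inv_mem hα)
  refine ⟨γ * (β * α⁻¹), mem_peripheral_of_smul_infty hΓ hinfty (Γ.mul_mem hγ (h₁ hδ)) ?_,
    (β * α⁻¹)⁻¹, Γ₁.inv_mem hδ, mul_inv_cancel_right _ _⟩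
  nth_rw 1 [← hα']
  rw [mul_smul, mul_smul, inv_smul_smul, hβ', smul_inv_smul]

theorem exists_peripheral_representatives {Γ Γ₁ : Subgroup PSL(2, ℂ)} {n : ℕ}
    (hdeg : Γ₁.relIndex Γ = n)
    (hprod : ∀ γ ∈ Γ, ∃ p ∈ peripheral Γ, ∃ δ ∈ Γ₁, p * δ = γ) :
    ∃ S ⊆ (peripheral Γ : Set PSL(2, ℂ)), IsCosetRepresentatives Γ Γ₁ n S := by
  have key : ∀ q : Γ ⧸ Γ₁.subgroupOf Γ, ∃ p : Γ, (p : PSL(2, ℂ)) ∈ peripheral Γ ∧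
      (p : Γ ⧸ Γ₁.subgroupOf Γ) = q := by
    intro q
    obtain ⟨γ, rfl⟩ := QuotientGroup.mk_surjective q
    obtain ⟨p, hp, δ, hδ, h⟩ := hprod γ γ.2
    refine ⟨⟨p, hp.1⟩, hp, QuotientGroup.eq.2 (Subgroup.mem_subgroupOf.2 ?_)⟩
    simpa [← h] using hδ
  choose r hrP hr using key
  have hinj : Function.Injective fun q => (r q : PSL(2, ℂ)) := fun q q' h => by
    rw [← hr q, ← hr q', Subtype.ext h]
  refine ⟨Set.range fun q => (r q : PSL(2, ℂ)), ?_, ?_, ?_, ?_⟩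
  · rintro _ ⟨q, rfl⟩
    exact hrP q
  · rintro _ ⟨q, rfl⟩
    exact (r q).2
  · rw [← Set.image_univ, Set.ncard_image_of_injective _ hinj, Set.ncard_univ]
    exact hdeg
  · intro γ hγ
    refine ⟨r (⟨γ, hγ⟩ : Γ), ⟨⟨_, rfl⟩, (r (⟨γ, hγ⟩ : Γ) : PSL(2, ℂ))⁻¹ * γ, ?_, by simp⟩, ?_⟩
    · exact Subgroup.mem_subgroupOf.1 (QuotientGroup.eq.1 (hr (⟨γ, hγ⟩ : Γ)))
    · rintro _ ⟨⟨q, rfl⟩, g, hg, h⟩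
      have : ((⟨γ, hγ⟩ : Γ) : Γ ⧸ Γ₁.subgroupOf Γ) = q := by
        rw [← hr q]
        refine (QuotientGroup.eq.2 (Subgroup.mem_subgroupOf.2 ?_)).symm
        simpa [h] using hg
      rw [this]

/-! ### Comparison of the Eisenstein series -/

/-- The map `P₁ γ ↦ P γ` from `P₁ \ Γ₁` to `P \ Γ`. -/
def peripheralCosetsMap {Γ Γ₁ : Subgroup PSL(2, ℂ)} (h₁ : Γ₁ ≤ Γ) :
    PeripheralCosets Γ₁ → PeripheralCosets Γ :=
  Quotient.map (Subgroup.inclusion h₁) fun γ δ h => by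
    obtain ⟨-, b, hb⟩ := Subgroup.mem_subgroupOf.1 (QuotientGroup.rightRel_apply.1 h)
    refine QuotientGroup.rightRel_apply.2 (Subgroup.mem_subgroupOf.2 ⟨SetLike.coe_mem _, b, hb⟩)

theorem eisensteinTerm_peripheralCosetsMap {Γ Γ₁ : Subgroup PSL(2, ℂ)} (h₁ : Γ₁ ≤ Γ) (w : H3)
    (s : ℂ) (q : PeripheralCosets Γ₁) :
    eisensteinTerm Γ w s (peripheralCosetsMap h₁ q) = eisensteinTerm Γ₁ w s q :=
  Quotient.inductionOn q fun _ => rfl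

theorem peripheralCosetsMap_bijective {Γ Γ₁ : Subgroup PSL(2, ℂ)} (h₁ : Γ₁ ≤ Γ)
    (hprod : ∀ γ ∈ Γ, ∃ p ∈ peripheral Γ, ∃ δ ∈ Γ₁, p * δ = γ) :
    Function.Bijective (peripheralCosetsMap h₁) := by
  constructor
  · intro q q'
    refine Quotient.inductionOn₂ q q' fun γ δ h => Quotient.sound ?_
    -- The peripheral subgroup of `Γ₁` is the intersection of `Γ₁` with that of `Γ`.
    obtain ⟨-, b, hb⟩ :=
      Subgroup.mem_subgroupOf.1 (QuotientGroup.rightRel_apply.1 (Quotient.exact h))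
    exact QuotientGroup.rightRel_apply.2 (Subgroup.mem_subgroupOf.2 ⟨SetLike.coe_mem _, b, hb⟩)
  · intro q
    refine Quotient.inductionOn q fun γ => ?_
    obtain ⟨p, hp, δ, hδ, h⟩ := hprod γ γ.2
    refine ⟨Quotient.mk _ ⟨δ, hδ⟩, Quotient.sound ?_⟩
    refine QuotientGroup.rightRel_apply.2 (Subgroup.mem_subgroupOf.2 ?_)
    simpa [← h] using hp

theorem hasSum_eisensteinTerm_iff {Γ Γ₁ : Subgroup PSL(2, ℂ)} (h₁ : Γ₁ ≤ Γ)
    (hprod : ∀ γ ∈ Γ, ∃ p ∈ peripheral Γ, ∃ δ ∈ Γ₁, p * δ = γ) (w : H3) (s a : ℂ) :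
    HasSum (eisensteinTerm Γ₁ w s) a ↔ HasSum (eisensteinTerm Γ w s) a := by
  rw [← (Equiv.ofBijective _ (peripheralCosetsMap_bijective h₁ hprod)).hasSum_iff]
  refine iff_of_eq (congrArg (HasSum · a) (funext fun q => ?_))
  exact (eisensteinTerm_peripheralCosetsMap h₁ w s q).symm

theorem eisenstein_eq {Γ Γ₁ : Subgroup PSL(2, ℂ)} (h₁ : Γ₁ ≤ Γ)
    (hprod : ∀ γ ∈ Γ, ∃ p ∈ peripheral Γ, ∃ δ ∈ Γ₁, p * δ = γ) (w : H3) (s : ℂ) :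
    eisenstein Γ₁ w s = eisenstein Γ w s := by
  unfold eisenstein
  rw [← (Equiv.ofBijective _ (peripheralCosetsMap_bijective h₁ hprod)).tsum_eq]
  exact tsum_congr fun q => (eisensteinTerm_peripheralCosetsMap h₁ w s q).symm

/-- Right multiplication by `α ∈ Γ` on `P \ Γ`. -/
def peripheralCosetsMulRight {Γ : Subgroup PSL(2, ℂ)} (α : Γ) :
    PeripheralCosets Γ ≃ PeripheralCosets Γ :=
  Quotient.congr (Equiv.mulRight α) fun γ δ => by
    change QuotientGroup.rightRel _ γ δ ↔ QuotientGroup.rightRel _ (γ * α) (δ * α)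
    simp [QuotientGroup.rightRel_apply]

theorem eisenstein_smul {Γ : Subgroup PSL(2, ℂ)} {α : PSL(2, ℂ)} (hα : α ∈ Γ) (w : H3) (s : ℂ) :
    eisenstein Γ (α • w) s = eisenstein Γ w s := by
  refine Eq.trans (tsum_congr fun q => Quotient.inductionOn q fun γ => ?_)
    ((peripheralCosetsMulRight (⟨α, hα⟩ : Γ)).tsum_eq (eisensteinTerm Γ w s))
  change (height (γ • α • w) : ℂ) ^ s = (height ((γ * ⟨α, hα⟩ : Γ) • w) : ℂ) ^ s
  rw [mul_smul]
  rfl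

theorem eisenstein_add_period {Γ : Subgroup PSL(2, ℂ)} {y : ℝ} (hy : 0 < y) (s : ℂ)
    (b : periods Γ) (z : ℂ) :
    eisenstein Γ (H3.mk (b +ᵥ z) y hy) s = eisenstein Γ (H3.mk z y hy) s := by
  rw [← eisenstein_smul b.2 (H3.mk z y hy) s, translation_smul, add_comm]
  rfl

/-! ### Meromorphic functions in normal form -/

/-- Identity theorem: a meromorphic function on `ℂ` in normal form is determined by its values on
a nonempty open set. -/
theorem _root_.MeromorphicNFOn.eq_of_eqOn_isOpen {f g : ℂ → ℂ} (hf : MeromorphicNFOn f Set.univ)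
    (hg : MeromorphicNFOn g Set.univ) {U : Set ℂ} (hU : IsOpen U) (hne : U.Nonempty)
    (h : Set.EqOn f g U) : f = g := by
  obtain ⟨x, hx⟩ := hne
  have hm : MeromorphicOn (f - g) Set.univ := hf.meromorphicOn.sub hg.meromorphicOn
  have htop : meromorphicOrderAt (f - g) x = ⊤ := by
    rw [meromorphicOrderAt_eq_top_iff]
    filter_upwards [nhdsWithin_le_nhds (hU.mem_nhds hx)] with y hy
    simp [h hy]
  ext z
  have hz : meromorphicOrderAt (f - g) z = ⊤ := by
    by_contra hne
    exact hm.meromorphicOrderAt_ne_top_of_isPreconnected isPreconnected_univ (Set.mem_univ z)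
      (Set.mem_univ x) hne htop
  rw [meromorphicOrderAt_eq_top_iff] at hz
  refine (((hf (Set.mem_univ z)).eventuallyEq_nhdsNE_iff_eventuallyEq_nhds
    (hg (Set.mem_univ z))).1 ?_).eq_of_nhds
  filter_upwards [hz] with y hy
  exact sub_eq_zero.1 hy

theorem _root_.MeromorphicNFOn.eq_of_eq_of_two_lt_re {f g : ℂ → ℂ}
    (hf : MeromorphicNFOn f Set.univ) (hg : MeromorphicNFOn g Set.univ)
    (h : ∀ s : ℂ, 2 < s.re → f s = g s) : f = g :=
  hf.eq_of_eqOn_isOpen hg (isOpen_lt continuous_const Complex.continuous_re)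
    ⟨3, by simp; norm_num⟩ h

/-! ### Averages over fundamental domains of a lattice and of a sublattice -/

open Pointwise

/-- A group of translations of `ℂ` whose nonzero elements are bounded away from `0` has a
fundamental domain: assign to `z` the first ball, in a countable cover by balls of a small radius,
that contains an `L`-translate of `z`, and keep the points lying in the ball assigned to them. -/
theorem exists_isAddFundamentalDomain {L : AddSubgroup ℂ}
    (hL : ∃ ε > 0, ∀ b ∈ L, ‖b‖ < ε → b = 0) :
    ∃ D : Set ℂ, IsAddFundamentalDomain L D volume := by
  classical
  obtain ⟨ε, hε, hL⟩ := hL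
  let B : ℕ → Set ℂ := fun k => Metric.ball (TopologicalSpace.denseSeq ℂ k) (ε / 2)
  -- `V k` is the union of the `L`-translates of the ball `B k`.
  let V : ℕ → Set ℂ := fun k => ⋃ l : L, (fun z => (l : ℂ) + z) ⁻¹' B k
  have hBo : ∀ k, IsOpen (B k) := fun k => Metric.isOpen_ball
  have hVo : ∀ k, IsOpen (V k) := fun k =>
    isOpen_iUnion fun l => (hBo k).preimage (by fun_prop)
  have hVinv : ∀ k (l : L) z, (l : ℂ) + z ∈ V k ↔ z ∈ V k := by
    intro k l z
    simp only [V, Set.mem_iUnion, Set.mem_preimage]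
    constructor
    · rintro ⟨m, hm⟩
      exact ⟨m + l, by simpa [add_assoc] using hm⟩
    · rintro ⟨m, hm⟩
      exact ⟨m - l, by simpa [← add_assoc] using hm⟩
  have hcov : ∀ z, ∃ k, z ∈ V k := fun z => by
    obtain ⟨k, hk⟩ := (TopologicalSpace.denseRange_denseSeq ℂ).exists_dist_lt z (half_pos hε)
    exact ⟨k, Set.mem_iUnion.2 ⟨0, by simpa [B] using hk⟩⟩
  refine ⟨⋃ k, B k \ ⋃ j < k, V j, .mk' ?_ fun z => ?_⟩
  · exact (MeasurableSet.iUnion fun k => (hBo k).measurableSet.diff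
      (.iUnion fun j => .iUnion fun _ => (hVo j).measurableSet)).nullMeasurableSet
  · have hmem : ∀ l : L, l +ᵥ z ∈ ⋃ k, B k \ ⋃ j < k, V j ↔
        (l : ℂ) + z ∈ B (Nat.find (hcov z)) := by
      intro l
      change (l : ℂ) + z ∈ _ ↔ _
      simp only [Set.mem_iUnion, Set.mem_sdiff, hVinv, not_exists]
      constructor
      · rintro ⟨k, hk, hlt⟩
        have : k = Nat.find (hcov z) := ((Nat.find_eq_iff (hcov z)).2
          ⟨Set.mem_iUnion.2 ⟨l, hk⟩, fun j hj => hlt j hj⟩).symm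
        rwa [← this]
      · exact fun h => ⟨_, h, fun j hj => Nat.find_min (hcov z) hj⟩
    simp only [hmem]
    obtain ⟨l, hl⟩ := Set.mem_iUnion.1 (Nat.find_spec (hcov z))
    refine ⟨l, hl, fun m hm => ?_⟩
    -- Two points of a ball of radius `ε / 2` are less than `ε` apart.
    have hlt : ‖((m : ℂ) - l)‖ < ε := by
      have := dist_triangle_right ((m : ℂ) + z) ((l : ℂ) + z)
        (TopologicalSpace.denseSeq ℂ (Nat.find (hcov z)))
      rw [dist_add_right, dist_eq_norm] at this
      have h1 := Metric.mem_ball.1 hm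
      have h2 := Metric.mem_ball.1 hl
      linarith
    exact Subtype.ext (sub_eq_zero.1 (hL _ (L.sub_mem m.2 l.2) hlt))

theorem countable_of_isolated {L : AddSubgroup ℂ}
    (hL : ∃ ε > 0, ∀ b ∈ L, ‖b‖ < ε → b = 0) : Countable L := by
  obtain ⟨ε, hε, hL⟩ := hL
  have : DiscreteTopology L := by
    refine discreteTopology_of_isOpen_singleton_zero ?_
    have : ({0} : Set L) = Subtype.val ⁻¹' Metric.ball (0 : ℂ) ε := by
      ext ⟨b, hb⟩
      simp only [Set.mem_singleton_iff, Set.mem_preimage, mem_ball_zero_iff]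
      refine ⟨fun h => ?_, fun h => Subtype.ext (hL b hb h)⟩
      rw [show b = 0 from congrArg Subtype.val h]
      simpa using hε
    rw [this]
    exact Metric.isOpen_ball.preimage continuous_subtype_val
  exact TopologicalSpace.separableSpace_iff_countable.1 inferInstance

section Sublattice

variable {L L₁ : AddSubgroup ℂ} {D : Set ℂ}

/-- The union of the translates of a fundamental domain of `L` by representatives of `L / L₁`. -/
def sublatticeDomain (L L₁ : AddSubgroup ℂ) (D : Set ℂ) : Set ℂ :=
  ⋃ q : L ⧸ L₁.addSubgroupOf L, q.out +ᵥ D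

theorem isAddFundamentalDomain_sublatticeDomain (h₁ : L₁ ≤ L)
    [Finite (L ⧸ L₁.addSubgroupOf L)] (hD : IsAddFundamentalDomain L D volume) :
    IsAddFundamentalDomain L₁ (sublatticeDomain L L₁ D) volume where
  nullMeasurableSet := .iUnion fun q => hD.nullMeasurableSet_vadd _
  ae_covers := by
    filter_upwards [hD.ae_covers] with x hx
    obtain ⟨l, hl⟩ := hx
    let q : L ⧸ L₁.addSubgroupOf L := (-l : L)
    have hmem : ((q.out + l : L) : ℂ) ∈ L₁ := by
      have := QuotientAddGroup.eq.1 (QuotientAddGroup.out_eq' q)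
      have := AddSubgroup.mem_addSubgroupOf.1 this
      have := L₁.neg_mem this
      simpa [add_comm] using this
    refine ⟨⟨_, hmem⟩, Set.mem_iUnion.2 ⟨q, Set.mem_vadd_set.2 ⟨l +ᵥ x, hl, ?_⟩⟩⟩
    change (q.out : ℂ) + ((l : ℂ) + x) = ((q.out + l : L) : ℂ) + x
    push_cast
    ring
  aedisjoint := by
    intro a b hab
    have hset : ∀ c : L₁, c +ᵥ sublatticeDomain L L₁ D =
        ⋃ q : L ⧸ L₁.addSubgroupOf L, (AddSubgroup.inclusion h₁ c + q.out) +ᵥ D := by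
      intro c
      rw [sublatticeDomain, Set.vadd_set_iUnion]
      refine Set.iUnion_congr fun q => ?_
      rw [add_vadd]
      rfl
    change AEDisjoint volume (a +ᵥ sublatticeDomain L L₁ D) (b +ᵥ sublatticeDomain L L₁ D)
    rw [hset, hset, AEDisjoint.iUnion_left_iff]
    intro q
    rw [AEDisjoint.iUnion_right_iff]
    intro q'
    refine hD.aedisjoint fun h => hab ?_
    -- Reduction modulo `L₁` shows `q = q'`, whence `a = b`.
    have hq : q = q' := by
      rw [← QuotientAddGroup.out_eq' q, ← QuotientAddGroup.out_eq' q']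
      refine QuotientAddGroup.eq.2 (AddSubgroup.mem_addSubgroupOf.2 ?_)
      have e : -q.out + q'.out = AddSubgroup.inclusion h₁ (a - b) := by
        rw [map_sub, neg_add_eq_sub, sub_eq_sub_iff_add_eq_add, add_comm, ← h]
      rw [e]
      exact (a - b).2
    rw [hq] at h
    exact AddSubgroup.inclusion_injective h₁ (add_right_cancel h)

theorem vadd_ae_disjoint (hD : IsAddFundamentalDomain L D volume) :
    Pairwise (Function.onFun (AEDisjoint volume)
      fun q : L ⧸ L₁.addSubgroupOf L => q.out +ᵥ D) := fun _ _ hq =>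
  hD.aedisjoint fun h => hq (Quotient.out_injective h)

theorem volume_sublatticeDomain [Finite (L ⧸ L₁.addSubgroupOf L)]
    (hD : IsAddFundamentalDomain L D volume) :
    volume (sublatticeDomain L L₁ D) = Nat.card (L ⧸ L₁.addSubgroupOf L) * volume D := by
  have := Fintype.ofFinite (L ⧸ L₁.addSubgroupOf L)
  rw [sublatticeDomain, measure_iUnion₀ (vadd_ae_disjoint hD)
    fun q => hD.nullMeasurableSet_vadd _, tsum_fintype]
  simp [measure_vadd]

theorem integrableOn_vadd_iff {f : ℂ → ℂ} (hf : ∀ (b : L) (z : ℂ), f (b +ᵥ z) = f z)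
    (hL : Countable L) (hD : IsAddFundamentalDomain L D volume) (l : L) :
    IntegrableOn f (l +ᵥ D) ↔ IntegrableOn f D :=
  (hD.vadd_of_comm l).integrableOn_iff hD hf

theorem integrableOn_sublatticeDomain_iff [Finite (L ⧸ L₁.addSubgroupOf L)] {f : ℂ → ℂ}
    (hf : ∀ (b : L) (z : ℂ), f (b +ᵥ z) = f z) (hL : Countable L)
    (hD : IsAddFundamentalDomain L D volume) :
    IntegrableOn f (sublatticeDomain L L₁ D) ↔ IntegrableOn f D := by
  rw [sublatticeDomain, integrableOn_finite_iUnion]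
  simp [integrableOn_vadd_iff hf hL hD]

theorem setAverage_sublatticeDomain [Finite (L ⧸ L₁.addSubgroupOf L)] {f : ℂ → ℂ}
    (hf : ∀ (b : L) (z : ℂ), f (b +ᵥ z) = f z) (hL : Countable L)
    (hD : IsAddFundamentalDomain L D volume) (hfi : IntegrableOn f D) :
    ⨍ z in sublatticeDomain L L₁ D, f z = ⨍ z in D, f z := by
  have hint : ∫ z in sublatticeDomain L L₁ D, f z =
      (Nat.card (L ⧸ L₁.addSubgroupOf L) : ℝ) • ∫ z in D, f z := by
    have := Fintype.ofFinite (L ⧸ L₁.addSubgroupOf L)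
    rw [sublatticeDomain, integral_iUnion_ae (fun q => hD.nullMeasurableSet_vadd _)
      (vadd_ae_disjoint hD) ((integrableOn_sublatticeDomain_iff hf hL hD).2 hfi), tsum_fintype]
    simp [(hD.vadd_of_comm _).setIntegral_eq hD hf]
  have hcard : (Nat.card (L ⧸ L₁.addSubgroupOf L) : ℝ) ≠ 0 :=
    Nat.cast_ne_zero.2 Nat.card_pos.ne'
  rw [setAverage_eq, setAverage_eq, hint, measureReal_def, volume_sublatticeDomain hD,
    ENNReal.toReal_mul, ENNReal.toReal_natCast, ← measureReal_def, smul_smul, mul_inv, mul_comm,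
    ← mul_assoc, mul_inv_cancel₀ hcard, one_mul]

end Sublattice

/-! ### Constant terms and scattering functions -/

/-- The constant term does not depend on the fundamental domain used to compute it. -/
theorem HasConstantTerm.unique {L : AddSubgroup ℂ} (hL : ∃ ε > 0, ∀ b ∈ L, ‖b‖ < ε → b = 0)
    {f : ℂ → ℂ} (hf : ∀ (b : L) (z : ℂ), f (b +ᵥ z) = f z) {a a' : ℂ}
    (h : HasConstantTerm L f a) (h' : HasConstantTerm L f a') : a = a' := by
  have := countable_of_isolated hL
  obtain ⟨D, hD, -, -, rfl⟩ := h
  obtain ⟨D', hD', -, -, rfl⟩ := h'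
  rw [setAverage_eq, setAverage_eq, hD.setIntegral_eq hD' hf, measureReal_def, measureReal_def,
    hD.measure_eq hD']

/-- The constant term of an `L`-periodic function may be computed with respect to a sublattice. -/
theorem hasConstantTerm_iff_of_le {L L₁ : AddSubgroup ℂ} (h₁ : L₁ ≤ L)
    (hL : ∃ ε > 0, ∀ b ∈ L, ‖b‖ < ε → b = 0) [Finite (L ⧸ L₁.addSubgroupOf L)]
    {f : ℂ → ℂ} (hf : ∀ (b : L) (z : ℂ), f (b +ᵥ z) = f z) (a : ℂ) :
    HasConstantTerm L₁ f a ↔ HasConstantTerm L f a := by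
  have hcount := countable_of_isolated hL
  have hL₁ : ∃ ε > 0, ∀ b ∈ L₁, ‖b‖ < ε → b = 0 :=
    hL.imp fun ε h => ⟨h.1, fun b hb => h.2 b (h₁ hb)⟩
  have hcount₁ := countable_of_isolated hL₁
  have hf₁ : ∀ (b : L₁) (z : ℂ), f (b +ᵥ z) = f z := fun b z => hf (AddSubgroup.inclusion h₁ b) z
  constructor
  · rintro ⟨D₁, hD₁, hvol, hint, rfl⟩
    -- Compare `D₁` with the domain of `L₁` assembled from translates of a domain `D` of `L`.
    obtain ⟨D, hD⟩ := exists_isAddFundamentalDomain hL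
    have hD' := isAddFundamentalDomain_sublatticeDomain h₁ hD
    have hint' := (hD₁.integrableOn_iff hD' hf₁).1 hint
    have hintD := (integrableOn_sublatticeDomain_iff hf hcount hD).1 hint'
    refine ⟨D, hD, ?_, hintD, ?_⟩
    · rw [hD₁.measure_eq hD', volume_sublatticeDomain hD] at hvol
      exact ENNReal.lt_top_of_mul_ne_top_right hvol.ne
        (Nat.cast_ne_zero.2 Nat.card_pos.ne')
    · rw [← setAverage_sublatticeDomain (L₁ := L₁) hf hcount hD hintD, setAverage_eq,
        setAverage_eq, hD₁.setIntegral_eq hD' hf₁, measureReal_def, measureReal_def,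
        hD₁.measure_eq hD']
  · rintro ⟨D, hD, hvol, hint, rfl⟩
    refine ⟨_, isAddFundamentalDomain_sublatticeDomain h₁ hD, ?_,
      (integrableOn_sublatticeDomain_iff hf hcount hD).2 hint,
      setAverage_sublatticeDomain hf hcount hD hint⟩
    rw [volume_sublatticeDomain hD]
    exact ENNReal.mul_lt_top (ENNReal.natCast_lt_top _) hvol

theorem finite_periods_quotient {Γ Γ₁ : Subgroup PSL(2, ℂ)} (hfin : Γ₁.relIndex Γ ≠ 0) :
    Finite (periods Γ ⧸ (periods Γ₁).addSubgroupOf (periods Γ)) := by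
  have : Finite (Γ ⧸ Γ₁.subgroupOf Γ) := Nat.finite_of_card_ne_zero hfin
  let t : periods Γ → Γ := fun b => ⟨translation b, b.2⟩
  refine Finite.of_injective (β := Γ ⧸ Γ₁.subgroupOf Γ) (fun q => t q.out) fun q q' h => ?_
  rw [← QuotientAddGroup.out_eq' q, ← QuotientAddGroup.out_eq' q']
  refine QuotientAddGroup.eq.2 (AddSubgroup.mem_addSubgroupOf.2 ?_)
  have hmem := Subgroup.mem_subgroupOf.1 (QuotientGroup.eq.1 h)
  change translation (-(q.out : ℂ) + q'.out) ∈ Γ₁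
  rwa [translation_add, translation_neg]

theorem hasConstantTerm_eisenstein_iff {Γ Γ₁ : Subgroup PSL(2, ℂ)}
    (hΓ : IsFiniteVolumeManifoldGroup Γ) (h₁ : Γ₁ ≤ Γ) (hfin : Γ₁.relIndex Γ ≠ 0)
    (hprod : ∀ γ ∈ Γ, ∃ p ∈ peripheral Γ, ∃ δ ∈ Γ₁, p * δ = γ) (s : ℂ) (y : ℝ) (hy : 0 < y)
    (a : ℂ) :
    HasConstantTerm (periods Γ₁) (fun z => eisenstein Γ₁ (H3.mk z y hy) s) a ↔
      HasConstantTerm (periods Γ) (fun z => eisenstein Γ (H3.mk z y hy) s) a := by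
  have := finite_periods_quotient hfin
  simp only [eisenstein_eq h₁ hprod]
  exact hasConstantTerm_iff_of_le (fun _ hb => h₁ hb)
    (exists_forall_mem_periods_norm_lt hΓ.discrete) (eisenstein_add_period hy s) a

theorem isEisensteinFunction_iff {Γ Γ₁ : Subgroup PSL(2, ℂ)} (h₁ : Γ₁ ≤ Γ)
    (hprod : ∀ γ ∈ Γ, ∃ p ∈ peripheral Γ, ∃ δ ∈ Γ₁, p * δ = γ) (F : H3 → ℂ → ℂ) :
    IsEisensteinFunction Γ₁ F ↔ IsEisensteinFunction Γ F := by
  simp only [IsEisensteinFunction, hasSum_eisensteinTerm_iff h₁ hprod]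

theorem isScatteringFunction_iff {Γ Γ₁ : Subgroup PSL(2, ℂ)}
    (hΓ : IsFiniteVolumeManifoldGroup Γ) (h₁ : Γ₁ ≤ Γ) (hfin : Γ₁.relIndex Γ ≠ 0)
    (hprod : ∀ γ ∈ Γ, ∃ p ∈ peripheral Γ, ∃ δ ∈ Γ₁, p * δ = γ) (φ : ℂ → ℂ) :
    IsScatteringFunction Γ₁ φ ↔ IsScatteringFunction Γ φ := by
  simp only [IsScatteringFunction, Summable, hasSum_eisensteinTerm_iff h₁ hprod,
    hasConstantTerm_eisenstein_iff hΓ h₁ hfin hprod]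

theorem IsEisensteinFunction.unique {Γ : Subgroup PSL(2, ℂ)} {F F' : H3 → ℂ → ℂ}
    (h : IsEisensteinFunction Γ F) (h' : IsEisensteinFunction Γ F') : F = F' :=
  funext fun w => (h w).1.eq_of_eq_of_two_lt_re (h' w).1 fun s hs =>
    ((h w).2 s hs).unique ((h' w).2 s hs)

theorem IsScatteringFunction.unique {Γ : Subgroup PSL(2, ℂ)} (hΓ : IsFiniteVolumeManifoldGroup Γ)
    {φ φ' : ℂ → ℂ} (h : IsScatteringFunction Γ φ) (h' : IsScatteringFunction Γ φ') : φ = φ' := by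
  refine h.1.eq_of_eq_of_two_lt_re h'.1 fun s hs => ?_
  -- At height `y = 1` the constant term is `1 + φ s`.
  have := (h.2 s hs 1 one_pos).2.unique (exists_forall_mem_periods_norm_lt hΓ.discrete)
    (eisenstein_add_period one_pos s) (h'.2 s hs 1 one_pos).2
  simpa using this

end CuspedHyp

theorem mainTheorem8 (Γ Γ₁ Γ₂ : Subgroup PSL(2, ℂ)) (n : ℕ)
    (hΓ : CuspedHyp.IsFiniteVolumeManifoldGroup Γ)
    (hcusp : CuspedHyp.HasOneCusp Γ)
    (hinfty : CuspedHyp.IsCuspOf Γ CuspedHyp.infty)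
    (hn : n ≠ 0)
    (h₁ : Γ₁ ≤ Γ) (hdeg₁ : Γ₁.relIndex Γ = n) (hcusp₁ : CuspedHyp.HasOneCusp Γ₁)
    (h₂ : Γ₂ ≤ Γ) (hdeg₂ : Γ₂.relIndex Γ = n) (hcusp₂ : CuspedHyp.HasOneCusp Γ₂) :
    -- coset representatives can be chosen in the peripheral subgroup
    (∃ S ⊆ (CuspedHyp.peripheral Γ : Set PSL(2, ℂ)),
      CuspedHyp.IsCosetRepresentatives Γ Γ₁ n S) ∧
    (∃ S ⊆ (CuspedHyp.peripheral Γ : Set PSL(2, ℂ)),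
      CuspedHyp.IsCosetRepresentatives Γ Γ₂ n S) ∧
    -- the three Eisenstein series coincide, as regards both convergence and value
    (∀ (w : CuspedHyp.H3) (s a : ℂ),
      (HasSum (CuspedHyp.eisensteinTerm Γ₁ w s) a ↔ HasSum (CuspedHyp.eisensteinTerm Γ w s) a) ∧
      (HasSum (CuspedHyp.eisensteinTerm Γ₂ w s) a ↔ HasSum (CuspedHyp.eisensteinTerm Γ w s) a)) ∧
    (∀ (w : CuspedHyp.H3) (s : ℂ),
      CuspedHyp.eisenstein Γ₁ w s = CuspedHyp.eisenstein Γ w s ∧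
      CuspedHyp.eisenstein Γ w s = CuspedHyp.eisenstein Γ₂ w s) ∧
    -- so do their meromorphic continuations
    (∀ F : CuspedHyp.H3 → ℂ → ℂ,
      (CuspedHyp.IsEisensteinFunction Γ₁ F ↔ CuspedHyp.IsEisensteinFunction Γ F) ∧
      (CuspedHyp.IsEisensteinFunction Γ₂ F ↔ CuspedHyp.IsEisensteinFunction Γ F)) ∧
    (∀ F₁ F₂ : CuspedHyp.H3 → ℂ → ℂ, CuspedHyp.IsEisensteinFunction Γ₁ F₁ →
      CuspedHyp.IsEisensteinFunction Γ₂ F₂ → F₁ = F₂) ∧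
    -- the constant terms of the Fourier expansions at the cusp coincide
    (∀ (s : ℂ) (y : ℝ) (hy : 0 < y) (a : ℂ),
      (CuspedHyp.HasConstantTerm (CuspedHyp.periods Γ₁)
          (fun z => CuspedHyp.eisenstein Γ₁ (CuspedHyp.H3.mk z y hy) s) a ↔
        CuspedHyp.HasConstantTerm (CuspedHyp.periods Γ)
          (fun z => CuspedHyp.eisenstein Γ (CuspedHyp.H3.mk z y hy) s) a) ∧
      (CuspedHyp.HasConstantTerm (CuspedHyp.periods Γ₂)
          (fun z => CuspedHyp.eisenstein Γ₂ (CuspedHyp.H3.mk z y hy) s) a ↔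
        CuspedHyp.HasConstantTerm (CuspedHyp.periods Γ)
          (fun z => CuspedHyp.eisenstein Γ (CuspedHyp.H3.mk z y hy) s) a)) ∧
    -- the scattering functions coincide
    (∀ φ : ℂ → ℂ,
      (CuspedHyp.IsScatteringFunction Γ₁ φ ↔ CuspedHyp.IsScatteringFunction Γ φ) ∧
      (CuspedHyp.IsScatteringFunction Γ₂ φ ↔ CuspedHyp.IsScatteringFunction Γ φ)) ∧
    (∀ φ₁ φ₂ : ℂ → ℂ, CuspedHyp.IsScatteringFunction Γ₁ φ₁ →
      CuspedHyp.IsScatteringFunction Γ₂ φ₂ → φ₁ = φ₂) := by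

  subst hdeg₁
  have hp₁ : ∀ γ ∈ Γ, ∃ p ∈ CuspedHyp.peripheral Γ, ∃ δ ∈ Γ₁, p * δ = γ := fun γ hγ =>
    CuspedHyp.exists_peripheral_mul_eq hΓ hinfty h₁ hn hcusp₁ hγ
  have hn₂ : Γ₂.relIndex Γ ≠ 0 := hdeg₂ ▸ hn
  have hp₂ : ∀ γ ∈ Γ, ∃ p ∈ CuspedHyp.peripheral Γ, ∃ δ ∈ Γ₂, p * δ = γ := fun γ hγ =>
    CuspedHyp.exists_peripheral_mul_eq hΓ hinfty h₂ hn₂ hcusp₂ hγ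
  refine ⟨CuspedHyp.exists_peripheral_representatives rfl hp₁,
    CuspedHyp.exists_peripheral_representatives hdeg₂ hp₂,
    fun w s a => ⟨CuspedHyp.hasSum_eisensteinTerm_iff h₁ hp₁ w s a,
      CuspedHyp.hasSum_eisensteinTerm_iff h₂ hp₂ w s a⟩,
    fun w s => ⟨CuspedHyp.eisenstein_eq h₁ hp₁ w s, (CuspedHyp.eisenstein_eq h₂ hp₂ w s).symm⟩,
    fun F => ⟨CuspedHyp.isEisensteinFunction_iff h₁ hp₁ F,
      CuspedHyp.isEisensteinFunction_iff h₂ hp₂ F⟩,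
    fun F₁ F₂ hF₁ hF₂ => ((CuspedHyp.isEisensteinFunction_iff h₁ hp₁ F₁).1 hF₁).unique
      ((CuspedHyp.isEisensteinFunction_iff h₂ hp₂ F₂).1 hF₂),
    fun s y hy a => ⟨CuspedHyp.hasConstantTerm_eisenstein_iff hΓ h₁ hn hp₁ s y hy a,
      CuspedHyp.hasConstantTerm_eisenstein_iff hΓ h₂ hn₂ hp₂ s y hy a⟩,
    fun φ => ⟨CuspedHyp.isScatteringFunction_iff hΓ h₁ hn hp₁ φ,
      CuspedHyp.isScatteringFunction_iff hΓ h₂ hn₂ hp₂ φ⟩,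
    fun φ₁ φ₂ hφ₁ hφ₂ => ((CuspedHyp.isScatteringFunction_iff hΓ h₁ hn hp₁ φ₁).1 hφ₁).unique hΓ
      ((CuspedHyp.isScatteringFunction_iff hΓ h₂ hn₂ hp₂ φ₂).1 hφ₂)⟩
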